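/- Let $m,n\ge 0$ be integers. Let $(M,g_M)$ be a smooth Riemannian manifold of dimension $2(m+n)+1$ with Levi-Civita connection $\nabla$, and let $(\phi,\xi,\eta)$ be a Sasakian structure on it: $\phi$ is a smooth $(1,1)$-tensor field, $\xi$ a smooth vector field and $\eta$ a smooth $1$-form with $$\phi\xi=0,\quad \eta\circ\phi=0,\quad \eta(\xi)=1,\quad \phi^2=-I+\eta\otimes\xi,\quad g_M(\phi X,\phi Y)=g_M(X,Y)-\eta(X)\eta(Y),$$ $$(\nabla_X\phi)Y=-g_M(X,Y)\xi+\eta(Y)X,\qquad \nabla_X\xi=\phi X .$$ Let $(N,g_N)$ be a smooth Riemannian manifold of dimension $m+2n+1$, and let $\pi:M\to N$ be a conformal anti-invariant $\xi^\perp$-submersion with dilation $\lambda$, that is: $\pi$ is a smooth submersion; $\lambda:M\to(0,\infty)$ is a function such that $\lambda^2 g_M(X,Y)=g_N(\pi_*X,\pi_*Y)$ for all $X,Y\in(\ker\pi_*)^\perp$; $\xi$ is orthogonal to $\ker\pi_*$; and $\phi(\ker\pi_*)\subset(\ker\pi_*)^\perp$. Then the tension field of $\pi$ is $$\tau(\pi)=-m\,\pi_*(\mu^{\ker\pi_*})+(1-m-2n)\,\pi_*(\operatorname{grad}\ln\lambda).$$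 Here $\tau(\pi)=\sum_i(\nabla\pi_*)(e_i,e_i)$ for a local orthonormal frame $(e_i)$ of $TM$, where $(\nabla\pi_*)(X,Y)=\nabla^\pi_X\pi_*Y-\pi_*(\nabla_XY)$ is the second fundamental form of $\pi$ and $\nabla^\pi$ is the pullback to $\pi^{-1}TN$ of the Levi-Civita connection of $N$; and $\mu^{\ker\pi_*}$ is the mean curvature vector field of the distribution $\ker\pi_*$, which has rank $m$, that is, $\frac1m\sum_{i=1}^m\mathcal H\nabla_{v_i}v_i$ for a local orthonormal frame $(v_i)$ of $\ker\pi_*$, with $\mathcal H$ the orthogonal projection onto $(\ker\pi_*)^\perp$ (and $0$ if $m=0$). -/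

import Mathlib

set_option linter.unusedSectionVars false

open Bundle Manifold
open scoped ContDiff Topology

noncomputable section LeviCivita

variable {E : Type*} [NormedAddCommGroup E] [NormedSpace ℝ E]
  {H : Type*} [TopologicalSpace H] (I : ModelWithCorners ℝ E H)
  {M : Type*} [TopologicalSpace M] [ChartedSpace H M]

instance tangentSpace_finiteDimensional [FiniteDimensional ℝ E] (x : M) :
    FiniteDimensional ℝ (TangentSpace I x) :=
  inferInstanceAs (FiniteDimensional ℝ E)

variable {I} in
theorem mvfderiv_congr_of_eventuallyEq {F : Type*} [NormedAddCommGroup F] [NormedSpace ℝ F]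
    {g h : M → F} {x : M} (hgh : g =ᶠ[𝓝 x] h) : mvfderiv I g x = mvfderiv I h x := by
  ext v
  exact congrArg (fun A : TangentSpace I x →L[ℝ] F ↦ A v) hgh.mfderiv_eq

variable [RiemannianBundle (fun x : M ↦ TangentSpace I x)]

/-- The Koszul expression, which for the Levi-Civita connection equals `2 g(∇_X Y, Z)` at `x`. -/
def koszul (X Y Z : Π x : M, TangentSpace I x) (x : M) : ℝ :=
  mvfderiv I (fun y ↦ inner ℝ (Y y) (Z y)) x (X x)
    + mvfderiv I (fun y ↦ inner ℝ (X y) (Z y)) x (Y x)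
    - mvfderiv I (fun y ↦ inner ℝ (X y) (Y y)) x (Z x)
    + inner ℝ (VectorField.mlieBracket I X Y x) (Z x)
    - inner ℝ (VectorField.mlieBracket I X Z x) (Y x)
    - inner ℝ (VectorField.mlieBracket I Y Z x) (X x)

variable [FiniteDimensional ℝ E] [IsManifold I ∞ M]
  [IsContMDiffRiemannianBundle I ∞ E (fun x : M ↦ TangentSpace I x)]

variable {I}
variable {X X' Y Y' Z Z' : Π x : M, TangentSpace I x} {x : M} {f : M → ℝ}

theorem inner_mdifferentiableAt (hX : MDiffAt (T% X) x) (hY : MDiffAt (T% Y) x) :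
    MDiffAt (fun y ↦ inner ℝ (X y) (Y y)) x :=
  MDifferentiableAt.inner_bundle (IB := I) (F := E) (E := fun x : M ↦ TangentSpace I x)
    (b := id) hX hY

theorem koszul_add_left (hX : MDiffAt (T% X) x) (hX' : MDiffAt (T% X') x)
    (hY : MDiffAt (T% Y) x) (hZ : MDiffAt (T% Z) x) :
    koszul I (X + X') Y Z x = koszul I X Y Z x + koszul I X' Y Z x := by
  have h1 := mvfderiv_fun_add (inner_mdifferentiableAt hX hZ) (inner_mdifferentiableAt hX' hZ)
  have h2 := mvfderiv_fun_add (inner_mdifferentiableAt hX hY) (inner_mdifferentiableAt hX' hY)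
  simp only [koszul, Pi.add_apply, inner_add_left, inner_add_right, h1, h2, map_add,
    VectorField.mlieBracket_add_left hX hX', add_apply]
  ring

theorem koszul_add_right (hX : MDiffAt (T% X) x) (hY : MDiffAt (T% Y) x)
    (hZ : MDiffAt (T% Z) x) (hZ' : MDiffAt (T% Z') x) :
    koszul I X Y (Z + Z') x = koszul I X Y Z x + koszul I X Y Z' x := by
  have h1 := mvfderiv_fun_add (inner_mdifferentiableAt hX hZ) (inner_mdifferentiableAt hX hZ')
  have h2 := mvfderiv_fun_add (inner_mdifferentiableAt hY hZ) (inner_mdifferentiableAt hY hZ')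
  simp only [koszul, Pi.add_apply, inner_add_left, inner_add_right, h1, h2, map_add,
    VectorField.mlieBracket_add_right hZ hZ', add_apply]
  ring

theorem koszul_add_middle (hX : MDiffAt (T% X) x) (hY : MDiffAt (T% Y) x)
    (hY' : MDiffAt (T% Y') x) (hZ : MDiffAt (T% Z) x) :
    koszul I X (Y + Y') Z x = koszul I X Y Z x + koszul I X Y' Z x := by
  have h1 := mvfderiv_fun_add (inner_mdifferentiableAt hY hZ) (inner_mdifferentiableAt hY' hZ)
  have h2 := mvfderiv_fun_add (inner_mdifferentiableAt hX hY) (inner_mdifferentiableAt hX hY')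
  simp only [koszul, Pi.add_apply, inner_add_left, inner_add_right, h1, h2, map_add,
    VectorField.mlieBracket_add_left hY hY', VectorField.mlieBracket_add_right hY hY',
    add_apply]
  ring

theorem koszul_smul_left (hf : MDiffAt f x) (hX : MDiffAt (T% X) x)
    (hY : MDiffAt (T% Y) x) (hZ : MDiffAt (T% Z) x) :
    koszul I (f • X) Y Z x = f x * koszul I X Y Z x := by
  have h1 := mvfderiv_fun_mul hf (inner_mdifferentiableAt hX hZ)
  have h2 := mvfderiv_fun_mul hf (inner_mdifferentiableAt hX hY)
  simp only [koszul, Pi.smul_apply', real_inner_smul_left, real_inner_smul_right, h1, h2,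
    map_smul, VectorField.mlieBracket_smul_left hf hX, add_apply,
    smul_apply, inner_add_left, smul_eq_mul]
  rw [real_inner_comm (Y x) (X x), real_inner_comm (Z x) (X x)]
  ring

theorem koszul_smul_right (hf : MDiffAt f x) (hX : MDiffAt (T% X) x)
    (hY : MDiffAt (T% Y) x) (hZ : MDiffAt (T% Z) x) :
    koszul I X Y (f • Z) x = f x * koszul I X Y Z x := by
  have h1 := mvfderiv_fun_mul hf (inner_mdifferentiableAt hX hZ)
  have h2 := mvfderiv_fun_mul hf (inner_mdifferentiableAt hY hZ)
  simp only [koszul, Pi.smul_apply', real_inner_smul_left, real_inner_smul_right, h1, h2,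
    map_smul, VectorField.mlieBracket_smul_right hf hZ, add_apply,
    smul_apply, inner_add_left, smul_eq_mul]
  rw [real_inner_comm (Y x) (Z x), real_inner_comm (X x) (Z x)]
  ring

theorem koszul_smul_middle (hf : MDiffAt f x) (hX : MDiffAt (T% X) x)
    (hY : MDiffAt (T% Y) x) (hZ : MDiffAt (T% Z) x) :
    koszul I X (f • Y) Z x =
      f x * koszul I X Y Z x + 2 * mvfderiv I f x (X x) * inner ℝ (Y x) (Z x) := by
  have h1 := mvfderiv_fun_mul hf (inner_mdifferentiableAt hX hY)
  have h2 := mvfderiv_fun_mul hf (inner_mdifferentiableAt hY hZ)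
  simp only [koszul, Pi.smul_apply', real_inner_smul_left, real_inner_smul_right, h1, h2,
    map_smul, VectorField.mlieBracket_smul_right hf hY, VectorField.mlieBracket_smul_left hf hY,
    add_apply,
    smul_apply, inner_add_left, smul_eq_mul]
  rw [real_inner_comm (X x) (Y x)]
  ring

theorem koszul_tensorial_left (hY : MDiffAt (T% Y) x) (hZ : MDiffAt (T% Z) x) :
    TensorialAt I E (fun X ↦ koszul I X Y Z x) x where
  smul hf hX := koszul_smul_left hf hX hY hZ
  add hX hX' := koszul_add_left hX hX' hY hZ

theorem koszul_tensorial_right (hX : MDiffAt (T% X) x) (hY : MDiffAt (T% Y) x) :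
    TensorialAt I E (fun Z ↦ koszul I X Y Z x) x where
  smul hf hZ := koszul_smul_right hf hX hY hZ
  add hZ hZ' := koszul_add_right hX hY hZ hZ'

/-- For a field `Y` differentiable at `x`, the bilinear form `(v, w) ↦ 2 g(∇_v Y, w)` on `T_x M`. -/
def koszulForm (hY : MDiffAt (T% Y) x) :
    TangentSpace I x →L[ℝ] TangentSpace I x →L[ℝ] ℝ :=
  TensorialAt.mkHom₂ (fun X Z ↦ koszul I X Y Z x) x
    (fun _ hZ ↦ koszul_tensorial_left hY hZ) (fun _ hX ↦ koszul_tensorial_right hX hY)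

theorem koszulForm_apply (hX : MDiffAt (T% X) x) (hY : MDiffAt (T% Y) x)
    (hZ : MDiffAt (T% Z) x) : koszulForm hY (X x) (Z x) = koszul I X Y Z x :=
  TensorialAt.mkHom₂_apply (Φ := fun X Z ↦ koszul I X Y Z x)
    (fun _ hZ ↦ koszul_tensorial_left hY hZ) (fun _ hX ↦ koszul_tensorial_right hX hY) hX hZ

variable (I) in
open scoped Classical in
/-- `∇ Y` at `x`, as a linear map `v ↦ ∇_v Y`: the Riesz dual of half the Koszul form. The value is
`0` (and never matters) where `Y` is not differentiable. -/
def leviCivitaAux (Y : Π x : M, TangentSpace I x) (x : M) :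
    TangentSpace I x →L[ℝ] TangentSpace I x :=
  if hY : MDiffAt (T% Y) x then
    LinearMap.toContinuousLinearMap
      { toFun := fun v ↦
          (InnerProductSpace.toDual ℝ (TangentSpace I x)).symm ((1 / 2 : ℝ) • koszulForm hY v)
        map_add' := fun v w ↦ by simp
        map_smul' := fun c v ↦ by simp [smul_comm c] }
  else 0

theorem inner_leviCivitaAux (hX : MDiffAt (T% X) x) (hY : MDiffAt (T% Y) x)
    (hZ : MDiffAt (T% Z) x) :
    inner ℝ (leviCivitaAux I Y x (X x)) (Z x) = (1 / 2 : ℝ) * koszul I X Y Z x := by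
  rw [← koszulForm_apply hX hY hZ, leviCivitaAux, dif_pos hY]
  exact InnerProductSpace.toDual_symm_apply

theorem leviCivitaAux_ext {A B : TangentSpace I x →L[ℝ] TangentSpace I x}
    (h : ∀ X Z : Π x : M, TangentSpace I x, MDiffAt (T% X) x → MDiffAt (T% Z) x →
      inner ℝ (A (X x)) (Z x) = inner ℝ (B (X x)) (Z x)) : A = B := by
  ext v
  refine ext_inner_right ℝ fun w ↦ ?_
  simpa using h (FiberBundle.extend E v) (FiberBundle.extend E w)
    (FiberBundle.mdifferentiableAt_extend ..) (FiberBundle.mdifferentiableAt_extend ..)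

variable (I M) in
/-- The Levi-Civita connection of a Riemannian manifold. -/
def leviCivita : CovariantDerivative I E (fun x : M ↦ TangentSpace I x) where
  toFun := leviCivitaAux I
  isCovariantDerivativeOnUniv :=
    { add := fun {Y Y' x} hY hY' _ ↦ leviCivitaAux_ext fun X Z hX hZ ↦ by
        have hs : MDiffAt (T% (Y + Y')) x := mdifferentiableAt_add_section hY hY'
        rw [inner_leviCivitaAux hX hs hZ, add_apply, inner_add_left,
          inner_leviCivitaAux hX hY hZ, inner_leviCivitaAux hX hY' hZ,
          koszul_add_middle hX hY hY' hZ]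
        ring
      leibniz := fun {Y f x} hY hf _ ↦ leviCivitaAux_ext fun X Z hX hZ ↦ by
        have hs : MDiffAt (T% (f • Y)) x := hf.smul_section hY
        rw [inner_leviCivitaAux hX hs hZ, koszul_smul_middle hf hX hY hZ]
        simp only [add_apply, smul_apply, inner_add_left,
          real_inner_smul_left, inner_leviCivitaAux hX hY hZ, ContinuousLinearMap.smulRight_apply]
        ring }

theorem inner_leviCivita (hX : MDiffAt (T% X) x) (hY : MDiffAt (T% Y) x)
    (hZ : MDiffAt (T% Z) x) :
    inner ℝ (leviCivita I M Y x (X x)) (Z x) = (1 / 2 : ℝ) * koszul I X Y Z x :=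
  inner_leviCivitaAux hX hY hZ

/-- The Levi-Civita connection is torsion free. -/
theorem leviCivita_torsion : (leviCivita I M).torsion = 0 := by
  rw [CovariantDerivative.torsion_eq_zero_iff]
  intro X Y x hX hY
  refine ext_inner_right ℝ fun w ↦ ?_
  have hZ : MDiffAt (T% (FiberBundle.extend E w : Π x : M, TangentSpace I x)) x :=
    FiberBundle.mdifferentiableAt_extend ..
  have h1 := inner_leviCivita hX hY hZ
  have h2 := inner_leviCivita hY hX hZ
  rw [FiberBundle.extend_apply_self] at h1 h2
  rw [inner_sub_left, h1, h2]
  simp only [koszul, FiberBundle.extend_apply_self]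
  simp only [VectorField.mlieBracket_swap_apply (V := Y) (W := X), inner_neg_left,
    real_inner_comm]
  ring

/-- The Levi-Civita connection is compatible with the metric. -/
theorem leviCivita_metric (hX : MDiffAt (T% X) x) (hY : MDiffAt (T% Y) x)
    (hZ : MDiffAt (T% Z) x) :
    mvfderiv I (fun y ↦ inner ℝ (Y y) (Z y)) x (X x) =
      inner ℝ (leviCivita I M Y x (X x)) (Z x) + inner ℝ (Y x) (leviCivita I M Z x (X x)) := by
  have h1 := inner_leviCivita hX hY hZ
  have h2 := inner_leviCivita hX hZ hY
  rw [h1, real_inner_comm, h2]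
  simp only [koszul]
  simp only [VectorField.mlieBracket_swap_apply (V := Z) (W := Y), inner_neg_left,
    real_inner_comm]
  ring

end LeviCivita

noncomputable section Maps

variable {E : Type*} [NormedAddCommGroup E] [NormedSpace ℝ E] [FiniteDimensional ℝ E]
  {H : Type*} [TopologicalSpace H] (I : ModelWithCorners ℝ E H)
  {M : Type*} [TopologicalSpace M] [ChartedSpace H M] [IsManifold I ∞ M]
  [RiemannianBundle (fun x : M ↦ TangentSpace I x)]
  [IsContMDiffRiemannianBundle I ∞ E (fun x : M ↦ TangentSpace I x)]
  {E' : Type*} [NormedAddCommGroup E'] [NormedSpace ℝ E'] [FiniteDimensional ℝ E']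
  {H' : Type*} [TopologicalSpace H'] (J : ModelWithCorners ℝ E' H')
  {N : Type*} [TopologicalSpace N] [ChartedSpace H' N] [IsManifold J ∞ N]
  [RiemannianBundle (fun y : N ↦ TangentSpace J y)]
  [IsContMDiffRiemannianBundle J ∞ E' (fun y : N ↦ TangentSpace J y)]

/-- The pullback connection `∇^f` on sections `σ` of `f⁻¹TN`. In the trivialization of `TN` at
`f x`, this is the derivative of the coordinate expression of `σ`, plus the covariant derivative in
the direction `f_* v` of the vector field on `N` that has constant coordinates and takes the value
`σ x` at `f x`. -/
def pullbackConnection (f : M → N) (σ : Π x : M, TangentSpace J (f x)) (x : M) :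
    TangentSpace I x →L[ℝ] TangentSpace J (f x) :=
  let e := trivializationAt E' (fun y : N ↦ TangentSpace J y) (f x)
  (e.symmL ℝ (f x)) ∘L (mvfderiv I (fun y ↦ (e ⟨f y, σ y⟩).2) x)
    + (leviCivita J N (FiberBundle.extend E' (σ x)) (f x)) ∘L (mfderiv I J f x)

section
variable {I J}
variable {f : M → N} {x : M}

/-- On a vector field along `f` of the form `W ∘ f`, one has `∇^f_v (W ∘ f) = ∇_{f_* v} W`. -/
theorem pullbackConnection_comp {W : Π y : N, TangentSpace J y} (hf : MDiffAt f x)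
    (hW : MDiffAt (T% W) (f x)) (v : TangentSpace I x) :
    pullbackConnection I J f (fun y ↦ W (f y)) x v =
      leviCivita J N W (f x) (mfderiv I J f x v) := by
  set e := trivializationAt E' (fun y : N ↦ TangentSpace J y) (f x) with he
  have hmem : f x ∈ e.baseSet := FiberBundle.mem_baseSet_trivializationAt' (f x)
  have hnhds : ∀ᶠ y in 𝓝 (f x), y ∈ e.baseSet := e.open_baseSet.mem_nhds hmem
  have hcoord : ∀ {W : Π y : N, TangentSpace J y}, MDiffAt (T% W) (f x) →
      MDiffAt (fun y ↦ (e ⟨y, W y⟩).2) (f x) := fun h ↦ (mdifferentiableAt_section J _).1 h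
  have hsymm : ∀ w : TangentSpace J (f x), e.symmL ℝ (f x) (e ⟨f x, w⟩).2 = w := fun w ↦
    (e.symmL_apply (R := ℝ) hmem _).trans (e.symm_apply_apply_mk hmem w)
  have htens : TensorialAt J E' (fun W : Π y : N, TangentSpace J y ↦
      leviCivita J N W (f x) (mfderiv I J f x v)
        - e.symmL ℝ (f x) (mvfderiv J (fun y ↦ (e ⟨y, W y⟩).2) (f x) (mfderiv I J f x v)))
      (f x) := by
    constructor
    · intro g W hg hW
      have h1 := (leviCivita J N).isCovariantDerivativeOnUniv.leibniz hW hg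
      have h2 : (fun y ↦ (e ⟨y, (g • W) y⟩).2) =ᶠ[𝓝 (f x)] fun y ↦ g y • (e ⟨y, W y⟩).2 := by
        filter_upwards [hnhds] with y hy
        exact (e.linear ℝ hy).map_smul (g y) (W y)
      have h3 := mvfderiv_fun_smul hg (hcoord hW)
      rw [mvfderiv_congr_of_eventuallyEq h2, h3, h1]
      simp only [add_apply, smul_apply, ContinuousLinearMap.smulRight_apply, map_add, map_smul,
        hsymm]
      module
    · intro W W' hW hW'
      have h1 := (leviCivita J N).isCovariantDerivativeOnUniv.add hW hW'
      have h2 : (fun y ↦ (e ⟨y, (W + W') y⟩).2) =ᶠ[𝓝 (f x)]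
          fun y ↦ (e ⟨y, W y⟩).2 + (e ⟨y, W' y⟩).2 := by
        filter_upwards [hnhds] with y hy
        exact (e.linear ℝ hy).map_add (W y) (W' y)
      have h3 := mvfderiv_fun_add (hcoord hW) (hcoord hW')
      rw [mvfderiv_congr_of_eventuallyEq h2, h3, h1]
      simp only [add_apply, map_add]
      module
  have hext := FiberBundle.mdifferentiableAt_extend J E' (W (f x))
  have key := htens.pointwise hW hext (by simp)
  have hconst : (fun y ↦ (e ⟨y, FiberBundle.extend E' (W (f x)) y⟩).2) =ᶠ[𝓝 (f x)]
      fun _ ↦ (e ⟨f x, W (f x)⟩).2 := by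
    filter_upwards [hnhds] with y hy
    simp [FiberBundle.extend, ← he, hy]
  have hchain : mvfderiv I (fun y ↦ (e ⟨f y, W (f y)⟩).2) x v =
      mvfderiv J (fun y ↦ (e ⟨y, W y⟩).2) (f x) (mfderiv I J f x v) :=
    congrArg (fun A : TangentSpace I x →L[ℝ] E' ↦ A v) (mfderiv_comp x (hcoord hW) hf)
  rw [mvfderiv_congr_of_eventuallyEq hconst, mvfderiv_const] at key
  simp only [zero_apply, map_zero, sub_zero] at key
  exact (congrArg₂ (· + ·) (congrArg (e.symmL ℝ (f x)) hchain) key.symm).trans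
    (add_sub_cancel _ _)

end

/-- The second fundamental form `(∇f_*)(X, Y) = ∇^f_X (f_* Y) - f_* (∇_X Y)` of a map `f`. -/
def secondFundamentalForm (f : M → N) (X Y : Π x : M, TangentSpace I x) (x : M) :
    TangentSpace J (f x) :=
  pullbackConnection I J f (fun y ↦ mfderiv I J f y (Y y)) x (X x)
    - mfderiv I J f x (leviCivita I M Y x (X x))

/-- The tension field of `f`: the trace of its second fundamental form over an orthonormal basis
of the tangent space (each basis vector extended to a local vector field). -/
def tensionField (f : M → N) (x : M) : TangentSpace J (f x) :=
  ∑ i, secondFundamentalForm I J f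
    (FiberBundle.extend E (stdOrthonormalBasis ℝ (TangentSpace I x) i))
    (FiberBundle.extend E (stdOrthonormalBasis ℝ (TangentSpace I x) i)) x

/-- The gradient of a real function on a Riemannian manifold. -/
def riemannianGradient (u : M → ℝ) (x : M) : TangentSpace I x :=
  (InnerProductSpace.toDual ℝ (TangentSpace I x)).symm (mvfderiv I u x)

/-- The vertical space `ker f_*` at `x`. -/
def verticalSpace (f : M → N) (x : M) : Submodule ℝ (TangentSpace I x) :=
  LinearMap.ker (mfderiv I J f x : TangentSpace I x →ₗ[ℝ] TangentSpace J (f x))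

/-- The horizontal space `(ker f_*)ᗮ` at `x`. -/
def horizontalSpace (f : M → N) (x : M) : Submodule ℝ (TangentSpace I x) :=
  (verticalSpace I J f x)ᗮ

/-- The vertical part of a vector field. -/
def verticalPart (f : M → N) (X : Π x : M, TangentSpace I x) (x : M) : TangentSpace I x :=
  (verticalSpace I J f x).starProjection (X x)

/-- The horizontal part of a vector field. -/
def horizontalPart (f : M → N) (X : Π x : M, TangentSpace I x) (x : M) : TangentSpace I x :=
  (horizontalSpace I J f x).starProjection (X x)

/-- For vertical fields `V`, `W`, the horizontal part of `∇_V W`: the second fundamental form of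
the distribution `ker f_*` (and of the fibres of `f`). -/
def verticalSecondFundamentalForm (f : M → N) (V W : Π x : M, TangentSpace I x) (x : M) :
    TangentSpace I x :=
  horizontalPart I J f (fun y ↦ leviCivita I M W y (V y)) x

/-- The mean curvature vector field of the distribution `ker f_*`: the mean of its second
fundamental form over an orthonormal basis of the vertical space (each basis vector extended to a
local vertical field). -/
def verticalMeanCurvature (f : M → N) (x : M) : TangentSpace I x :=
  (Module.finrank ℝ (verticalSpace I J f x) : ℝ)⁻¹ •
    ∑ i, verticalSecondFundamentalForm I J f
      (verticalPart I J f
        (FiberBundle.extend E (stdOrthonormalBasis ℝ (verticalSpace I J f x) i : TangentSpace I x)))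
      (verticalPart I J f
        (FiberBundle.extend E (stdOrthonormalBasis ℝ (verticalSpace I J f x) i : TangentSpace I x)))
      x

/-- A horizontally conformal submersion with dilation `lam`. -/
structure IsHorizontallyConformalSubmersion (f : M → N) (lam : M → ℝ) : Prop where
  contMDiff : ContMDiff I J ∞ f
  surjective_mfderiv : ∀ x, Function.Surjective (mfderiv I J f x)
  pos : ∀ x, 0 < lam x
  conformal : ∀ x, ∀ X ∈ horizontalSpace I J f x, ∀ Y ∈ horizontalSpace I J f x,
    lam x ^ 2 * inner ℝ X Y = inner ℝ (mfderiv I J f x X) (mfderiv I J f x Y)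

variable (M) in
/-- An almost contact metric structure `(φ, ξ, η)` on a Riemannian manifold `M`. -/
structure AlmostContactMetricStructure where
  φ : Π x : M, TangentSpace I x →L[ℝ] TangentSpace I x
  ξ : Π x : M, TangentSpace I x
  η : Π x : M, TangentSpace I x →L[ℝ] ℝ
  contMDiff_φ : ContMDiff I (I.prod 𝓘(ℝ, E →L[ℝ] E)) ∞
    (fun x ↦ TotalSpace.mk' (E →L[ℝ] E)
      (E := fun x : M ↦ TangentSpace I x →L[ℝ] TangentSpace I x) x (φ x))
  contMDiff_ξ : ContMDiff I (I.prod 𝓘(ℝ, E)) ∞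
    (fun x ↦ TotalSpace.mk' E (E := fun x : M ↦ TangentSpace I x) x (ξ x))
  contMDiff_η : ContMDiff I (I.prod 𝓘(ℝ, E →L[ℝ] ℝ)) ∞
    (fun x ↦ TotalSpace.mk' (E →L[ℝ] ℝ) (E := fun x : M ↦ TangentSpace I x →L[ℝ] ℝ) x (η x))
  φ_ξ : ∀ x, φ x (ξ x) = 0
  η_φ : ∀ x v, η x (φ x v) = 0
  η_ξ : ∀ x, η x (ξ x) = 1
  φ_φ : ∀ x v, φ x (φ x v) = -v + η x v • ξ x
  inner_φ_φ : ∀ x v w, inner ℝ (φ x v) (φ x w) = inner ℝ v w - η x v * η x w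

variable {I}

/-- The almost contact metric structure is Sasakian:
`(∇_X φ) Y = -g(X, Y) ξ + η(Y) X` and `∇_X ξ = φ X`, where `(∇_X φ) Y = ∇_X (φ Y) - φ (∇_X Y)`. -/
structure AlmostContactMetricStructure.IsSasakian (S : AlmostContactMetricStructure I M) :
    Prop where
  cov_φ : ∀ (x : M) (v : TangentSpace I x) (Y : Π x : M, TangentSpace I x), MDiffAt (T% Y) x →
    leviCivita I M (fun y ↦ S.φ y (Y y)) x v - S.φ x (leviCivita I M Y x v) =
      -(inner ℝ v (Y x)) • S.ξ x + S.η x (Y x) • v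
  cov_ξ : ∀ (x : M) (v : TangentSpace I x), leviCivita I M S.ξ x v = S.φ x v

/-- A conformal anti-invariant `ξᗮ`-submersion with dilation `lam`: a horizontally conformal
submersion such that `ξ` is orthogonal to `ker f_*` and `φ (ker f_*) ⊆ (ker f_*)ᗮ`. -/
structure AlmostContactMetricStructure.IsConformalAntiInvariantSubmersion
    (S : AlmostContactMetricStructure I M) (f : M → N) (lam : M → ℝ) : Prop
    extends IsHorizontallyConformalSubmersion I J f lam where
  ξ_mem : ∀ x, S.ξ x ∈ horizontalSpace I J f x
  φ_mem : ∀ x, ∀ v ∈ verticalSpace I J f x, S.φ x v ∈ horizontalSpace I J f x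

end Maps

/-!
The formula holds for every horizontally conformal submersion `f : M → N` with dilation `λ`:
`τ(f) = -r f_* μ + (2 - dim N) f_* grad (ln λ)`, where `r` is the dimension of the fibres;
here `dim N = m + 2n + 1` and `r = dim M - dim N = m`.

The second fundamental form of `f` is tensorial (`secondFundamentalFormAt`), so `τ(f)` is the trace
of a bilinear map on `T_x M`, and by `sum_bilin_starProjection` this trace splits into a sum over an
orthonormal basis of the vertical space and one over an orthonormal basis of the horizontal space.

* For a vertical field `V` one has `f_* V = 0`, hence `(∇f_*)(V, V) = -f_*(∇_V V)`
  (`secondFundamentalFormAt_vertical`); these terms add up to `-r f_* μ`.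
* For a horizontal vector `h` one has
  `(∇f_*)(h, h) = 2 h(ln λ) f_* h - g(h, h) f_* grad (ln λ)` (`secondFundamentalFormAt_horizontal`);
  these terms add up to `(2 - dim N) f_* grad (ln λ)`. To prove the identity, `h` is extended by the
  horizontal lift `X` of a field `W` on `N`, so that `∇^f_X (f_* X) = ∇_W W` along `f`, and the
  Koszul formulas for `∇_X X` and `∇_W W` are compared (`koszul_horizontalLift`): lifts satisfy
  `g(X, X') = λ⁻² g(W, W')`, and their Lie brackets are `f`-related to those of the fields on `N`
  (`mfderiv_mlieBracket_of_related`).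

Projections, lifts and `λ²` are handled through the adjoint `f_*ᵀ` of the differential:
conformality says `f_* f_*ᵀ = λ²`, so `λ⁻² f_*ᵀ f_*` is the horizontal projection, `λ⁻² f_*ᵀ W` is
the horizontal lift of `W`, and `λ²` is a quotient of differentiable functions. That `f_*ᵀ`
preserves differentiability is a consequence of `mdifferentiableAt_of_inner`.
-/

/-! ### Lie brackets of related vector fields -/

section Brackets

variable {E : Type*} [NormedAddCommGroup E] [NormedSpace ℝ E]
  {H : Type*} [TopologicalSpace H] {I : ModelWithCorners ℝ E H}
  {M : Type*} [TopologicalSpace M] [ChartedSpace H M] [IsManifold I ∞ M]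
  {E' : Type*} [NormedAddCommGroup E'] [NormedSpace ℝ E']
  {H' : Type*} [TopologicalSpace H'] {J : ModelWithCorners ℝ E' H'}
  {N : Type*} [TopologicalSpace N] [ChartedSpace H' N] [IsManifold J ∞ N]
  {F : Type*} [NormedAddCommGroup F] [NormedSpace ℝ F]
  {X Y : Π x : M, TangentSpace I x} {x : M}

/-- For a differentiable vector field `Y`, the field `f_* Y` along `f` is differentiable. -/
theorem mdifferentiableAt_mfderiv_apply {f : M → N} (hf : ContMDiffAt I J 2 f x)
    (hY : MDiffAt (T% Y) x) :
    MDifferentiableAt I J.tangent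
      (fun y ↦ (⟨f y, mfderiv I J f y (Y y)⟩ : TangentBundle J N)) x := by
  have h1 : MDifferentiableAt I 𝓘(ℝ, E →L[ℝ] E')
      (inTangentCoordinates I J id f (mfderiv I J f) x) x :=
    (hf.mfderiv_const (m := 1) le_rfl).mdifferentiableAt one_ne_zero
  exact MDifferentiableAt.clm_apply_of_inCoordinates (b₁ := id) h1 hY
    (hf.mdifferentiableAt two_ne_zero)

theorem mdifferentiableAt_mvfderiv_apply {u : M → F} (hu : ContMDiffAt I 𝓘(ℝ, F) 2 u x)
    (hY : MDiffAt (T% Y) x) : MDiffAt (fun y ↦ mvfderiv I u y (Y y)) x :=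
  ((contMDiff_snd_tangentBundle_modelSpace F 𝓘(ℝ, F)).contMDiffAt.mdifferentiableAt
    (n := 1) one_ne_zero).comp x (mdifferentiableAt_mfderiv_apply hu hY)

/-- Differentiation along a vector field, read in the chart at `x`, at any point of the chart. -/
theorem fderiv_comp_extChartAt_symm_apply [I.Boundaryless] {g : M → F} {z : E}
    (hz : z ∈ (extChartAt I x).target) (hg : MDiffAt g ((extChartAt I x).symm z)) :
    fderiv ℝ (g ∘ (extChartAt I x).symm) z
        (VectorField.mpullbackWithin 𝓘(ℝ, E) I (extChartAt I x).symm X (Set.range I) z) =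
      mvfderiv I g ((extChartAt I x).symm z) (X ((extChartAt I x).symm z)) := by
  have h0 := isInvertible_mfderivWithin_extChartAt_symm hz
  have h1 := mdifferentiableWithinAt_extChartAt_symm hz
  rw [VectorField.mpullbackWithin_apply]
  rw [I.range_eq_univ, mfderivWithin_univ] at *
  rw [mdifferentiableWithinAt_univ] at h1
  have h2 := mfderiv_comp_apply z hg h1 ((mfderiv 𝓘(ℝ, E) I (extChartAt I x).symm z).inverse
    (X ((extChartAt I x).symm z)))
  rw [mfderiv_eq_fderiv, h0.self_apply_inverse] at h2
  exact h2

/-- At the base point of the chart, tangent vectors are their own coordinates. -/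
theorem mvfderiv_eq_fderiv_comp_extChartAt_symm [I.Boundaryless] {g : M → F} (hg : MDiffAt g x)
    (v : TangentSpace I x) :
    mvfderiv I g x v = fderiv ℝ (g ∘ (extChartAt I x).symm) (extChartAt I x x) v := by
  have h := hg.mfderiv
  rw [I.range_eq_univ, fderivWithin_univ] at h
  exact congrArg (fun A : E →L[ℝ] F ↦ A v) h

/-- The Lie bracket is the commutator of derivations. -/
theorem mvfderiv_mlieBracket [CompleteSpace E] [I.Boundaryless] {u : M → F}
    (hu : ContMDiffAt I 𝓘(ℝ, F) 2 u x) (hX : MDiffAt (T% X) x) (hY : MDiffAt (T% Y) x) :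
    mvfderiv I u x (VectorField.mlieBracket I X Y x) =
      mvfderiv I (fun y ↦ mvfderiv I u y (Y y)) x (X x) -
        mvfderiv I (fun y ↦ mvfderiv I u y (X y)) x (Y x) := by
  set ψ := (extChartAt I x).symm with hψ
  set p := extChartAt I x x with hp
  have hpx : ψ p = x := extChartAt_to_inv x
  set X' : E → E := VectorField.mpullbackWithin 𝓘(ℝ, E) I ψ X (Set.range I) with hX'
  set Y' : E → E := VectorField.mpullbackWithin 𝓘(ℝ, E) I ψ Y (Set.range I) with hY'
  have hL : VectorField.mlieBracket I X Y x = VectorField.lieBracket ℝ X' Y' p := by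
    have h1 : (mfderiv I 𝓘(ℝ, E) (extChartAt I x) x).inverse = ContinuousLinearMap.id ℝ E :=
      (congrArg (fun A : E →L[ℝ] E ↦ A.inverse) mfderiv_extChartAt_self).trans
        ContinuousLinearMap.inverse_id
    have h2 : VectorField.lieBracketWithin ℝ X' Y' (ψ ⁻¹' Set.univ ∩ Set.range I) p =
        VectorField.lieBracket ℝ X' Y' p := by
      rw [Set.preimage_univ, Set.univ_inter, I.range_eq_univ, VectorField.lieBracketWithin_univ]
    exact (congrArg (fun A : E →L[ℝ] E ↦ A _) h1).trans h2
  have hdiff : ∀ {Z : Π y : M, TangentSpace I y}, MDiffAt (T% Z) x →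
      DifferentiableAt ℝ (VectorField.mpullbackWithin 𝓘(ℝ, E) I ψ Z (Set.range I)) p := by
    intro Z hZ
    refine (MDifferentiableWithinAt.differentiableWithinAt_mpullbackWithin_vectorField
      (mdifferentiableWithinAt_univ.2 hZ)).differentiableAt ?_
    simp [I.range_eq_univ]
  have hu' : ContDiffAt ℝ 2 (u ∘ ψ) p := by
    have h := (contMDiffAt_iff.1 hu).2
    rw [I.range_eq_univ, contDiffWithinAt_univ] at h
    exact h
  -- the derivative of `u` along a field, read in the chart, near the base point
  have hev : ∀ Z : Π y : M, TangentSpace I y, (fun z ↦ fderiv ℝ (u ∘ ψ) z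
      (VectorField.mpullbackWithin 𝓘(ℝ, E) I ψ Z (Set.range I) z)) =ᶠ[𝓝 p]
      (fun y ↦ mvfderiv I u y (Z y)) ∘ ψ := by
    intro Z
    have h1 : ∀ᶠ y in 𝓝 (ψ p), MDiffAt u y := by
      rw [hpx]
      filter_upwards [contMDiffAt_iff_contMDiffAt_nhds (by simp) |>.1 hu] with y hy
      exact hy.mdifferentiableAt two_ne_zero
    filter_upwards [extChartAt_target_mem_nhds (I := I) x,
      (continuousAt_extChartAt_symm (I := I) x).eventually h1] with z hz hz1
    exact fderiv_comp_extChartAt_symm_apply hz hz1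
  have hpt : ∀ (Z : Π y : M, TangentSpace I y),
      VectorField.mpullbackWithin 𝓘(ℝ, E) I ψ Z (Set.range I) p = Z x := by
    intro Z
    rw [VectorField.mpullbackWithin_apply, hpx]
    exact mfderivWithin_extChartAt_symm_inverse_apply (Z x)
  have hbr : mvfderiv I u x (VectorField.mlieBracket I X Y x) =
      fderiv ℝ (u ∘ ψ) p (VectorField.lieBracket ℝ X' Y' p) :=
    (mvfderiv_eq_fderiv_comp_extChartAt_symm (hu.mdifferentiableAt two_ne_zero) _).trans
      (congrArg (fderiv ℝ (u ∘ ψ) p) hL)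
  rw [hbr,
    mvfderiv_eq_fderiv_comp_extChartAt_symm (mdifferentiableAt_mvfderiv_apply hu hX),
    mvfderiv_eq_fderiv_comp_extChartAt_symm (mdifferentiableAt_mvfderiv_apply hu hY),
    ← (hev X).fderiv_eq, ← (hev Y).fderiv_eq, ← hpt X, ← hpt Y]
  exact VectorField.fderiv_apply_lieBracket hu' (by simp) (hdiff hY) (hdiff hX)

/-- The Lie brackets of two pairs of `f`-related vector fields are `f`-related. -/
theorem mfderiv_mlieBracket_of_related [CompleteSpace E] [CompleteSpace E'] [I.Boundaryless]
    [J.Boundaryless] {f : M → N} {V W : Π y : N, TangentSpace J y} (hf : ContMDiffAt I J 2 f x)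
    (hX : MDiffAt (T% X) x) (hY : MDiffAt (T% Y) x)
    (hV : MDiffAt (T% V) (f x)) (hW : MDiffAt (T% W) (f x))
    (hXV : ∀ᶠ y in 𝓝 x, mfderiv I J f y (X y) = V (f y))
    (hYW : ∀ᶠ y in 𝓝 x, mfderiv I J f y (Y y) = W (f y)) :
    mfderiv I J f x (VectorField.mlieBracket I X Y x) = VectorField.mlieBracket J V W (f x) := by
  -- both sides are compared after differentiating the chart `u` of `N` at `f x`
  set u : N → E' := fun y ↦ extChartAt J (f x) y
  have hu : ContMDiffAt J 𝓘(ℝ, E') 2 u (f x) := contMDiffAt_extChartAt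
  have huf : ContMDiffAt I 𝓘(ℝ, E') 2 (u ∘ f) x := hu.comp x hf
  have hfx := hf.mdifferentiableAt two_ne_zero
  have hchain : ∀ {g : N → E'} {y : M}, MDiffAt g (f y) → MDiffAt f y → ∀ v,
      mvfderiv I (g ∘ f) y v = mvfderiv J g (f y) (mfderiv I J f y v) := fun hg hf v ↦
    congrArg (fun A : TangentSpace I _ →L[ℝ] E' ↦ A v) (mfderiv_comp _ hg hf)
  have hev : ∀ {X : Π y : M, TangentSpace I y} {V : Π y : N, TangentSpace J y},
      (∀ᶠ y in 𝓝 x, mfderiv I J f y (X y) = V (f y)) →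
      (fun y ↦ mvfderiv I (u ∘ f) y (X y)) =ᶠ[𝓝 x] (fun y ↦ mvfderiv J u y (V y)) ∘ f := by
    intro X V h
    filter_upwards [h, contMDiffAt_iff_contMDiffAt_nhds (by simp) |>.1 hf,
      hf.continuousAt.eventually (contMDiffAt_iff_contMDiffAt_nhds (by simp) |>.1 hu)]
      with y hy h1 h2
    rw [hchain (h2.mdifferentiableAt two_ne_zero) (h1.mdifferentiableAt two_ne_zero), hy]
    rfl
  have h1 := mvfderiv_mlieBracket huf hX hY
  have h2 := mvfderiv_mlieBracket hu hV hW
  rw [mvfderiv_congr_of_eventuallyEq (hev hXV), mvfderiv_congr_of_eventuallyEq (hev hYW),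
    hchain (mdifferentiableAt_mvfderiv_apply hu hW) hfx,
    hchain (mdifferentiableAt_mvfderiv_apply hu hV) hfx,
    hchain (hu.mdifferentiableAt two_ne_zero) hfx, hXV.self_of_nhds, hYW.self_of_nhds, ← h2] at h1
  -- the differential of `u` at the base point is the identity
  have h3 : ∀ v : TangentSpace J (f x), mvfderiv J u (f x) v = v := fun v ↦
    congrArg (fun A : E' →L[ℝ] E' ↦ A v) mfderiv_extChartAt_self
  exact (h3 _).symm.trans (h1.trans (h3 _))

end Brackets

/-! ### Differentiability of a vector field from its inner products -/

section Musical

variable {E : Type*} [NormedAddCommGroup E] [NormedSpace ℝ E] [FiniteDimensional ℝ E]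
  {H : Type*} [TopologicalSpace H] {I : ModelWithCorners ℝ E H}
  {M : Type*} [TopologicalSpace M] [ChartedSpace H M]
  {F : Type*} [NormedAddCommGroup F] [NormedSpace ℝ F]
  {G : Type*} [NormedAddCommGroup G] [NormedSpace ℝ G] {x : M}

/-- A family of linear maps on a finite-dimensional space is differentiable as soon as its
evaluations are. -/
theorem MDifferentiableAt.clm_of_forall_apply [FiniteDimensional ℝ F] {A : M → F →L[ℝ] G}
    (h : ∀ v, MDiffAt (fun y ↦ A y v) x) : MDiffAt A x := by
  let b := Module.finBasis ℝ F
  have hA : A = ∑ i, fun y ↦ ContinuousLinearMap.smulRightL ℝ F G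
      (LinearMap.toContinuousLinearMap (b.coord i)) (A y (b i)) := by
    funext y
    refine ContinuousLinearMap.coe_injective (b.ext fun j ↦ ?_)
    simp [Finsupp.single_apply]
  rw [hA]
  refine MDifferentiableAt.sum fun i _ ↦ ?_
  exact (ContinuousLinearMap.mdifferentiableAt _).comp x (h (b i))

theorem isInvertible_of_forall_ne_zero [FiniteDimensional ℝ F] {A : F →L[ℝ] F →L[ℝ] ℝ}
    (h : ∀ v, v ≠ 0 → A v v ≠ 0) : A.IsInvertible := by
  have hinj : Function.Injective (A : F →ₗ[ℝ] F →L[ℝ] ℝ) := by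
    refine LinearMap.ker_eq_bot.1 ((Submodule.eq_bot_iff _).2 fun v hv ↦ ?_)
    by_contra hv0
    have : A v = 0 := hv
    exact h v hv0 (by simp [this])
  have hdim : Module.finrank ℝ F = Module.finrank ℝ (F →L[ℝ] ℝ) := by
    rw [← (LinearMap.toContinuousLinearMap (𝕜 := ℝ) (E := F) (F' := ℝ)).finrank_eq]
    exact Subspace.dual_finrank_eq.symm
  exact ⟨(LinearEquiv.ofInjectiveOfFinrankEq _ hinj hdim).toContinuousLinearEquiv, by ext; rfl⟩

variable [IsManifold I ∞ M] [RiemannianBundle (fun x : M ↦ TangentSpace I x)]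
  [IsContMDiffRiemannianBundle I ∞ E (fun x : M ↦ TangentSpace I x)]

/-- A vector field is differentiable at a point as soon as its inner products with the
differentiable vector fields are: in a trivialization its coordinates are obtained from these inner
products by inverting the matrix of the metric. -/
theorem mdifferentiableAt_of_inner {σ : Π y : M, TangentSpace I y}
    (h : ∀ Z : Π y : M, TangentSpace I y, MDiffAt (T% Z) x →
      MDiffAt (fun y ↦ inner ℝ (σ y) (Z y)) x) : MDiffAt (T% σ) x := by
  set e := trivializationAt E (fun y : M ↦ TangentSpace I y) x with he
  have hmem : x ∈ e.baseSet := FiberBundle.mem_baseSet_trivializationAt' x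
  have hnhds : ∀ᶠ y in 𝓝 x, y ∈ e.baseSet := e.open_baseSet.mem_nhds hmem
  -- the vector fields with constant coordinates
  let s : E → Π y : M, TangentSpace I y := fun v y ↦ e.symmL ℝ y v
  have hs : ∀ v, MDiffAt (T% (s v)) x := by
    intro v
    have h1 := FiberBundle.mdifferentiableAt_extend I E (e.symmL ℝ x v)
    have h2 : ∀ᶠ y in 𝓝 x, TotalSpace.mk' E y (s v y) =
        TotalSpace.mk' E y (FiberBundle.extend E (e.symmL ℝ x v) y) := by
      filter_upwards [hnhds] with y hy
      simp [s, FiberBundle.extend, ← he, hmem, hy]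
    exact h1.congr_of_eventuallyEq h2
  -- the metric, and the inner product with `σ`, in coordinates
  let A : M → E →L[ℝ] E →L[ℝ] ℝ := fun y ↦ LinearMap.toContinuousBilinearMap
    (LinearMap.mk₂ ℝ (fun v w ↦ inner ℝ (s v y) (s w y))
      (fun _ _ _ ↦ by simp [s, inner_add_left]) (fun _ _ _ ↦ by simp [s, inner_smul_left])
      (fun _ _ _ ↦ by simp [s, inner_add_right]) (fun _ _ _ ↦ by simp [s, inner_smul_right]))
  let l : M → E →L[ℝ] ℝ := fun y ↦ LinearMap.toContinuousLinearMap
    { toFun := fun w ↦ inner ℝ (σ y) (s w y)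
      map_add' := fun _ _ ↦ by simp [s, inner_add_right]
      map_smul' := fun _ _ ↦ by simp [s, inner_smul_right] }
  have hA : MDiffAt A x := MDifferentiableAt.clm_of_forall_apply fun v ↦
    MDifferentiableAt.clm_of_forall_apply fun w ↦ inner_mdifferentiableAt (hs v) (hs w)
  have hl : MDiffAt l x := MDifferentiableAt.clm_of_forall_apply fun w ↦ h _ (hs w)
  have hse : ∀ y ∈ e.baseSet, ∀ w : TangentSpace I y, s (e ⟨y, w⟩).2 y = w := fun y hy w ↦
    (e.symmL_apply (R := ℝ) hy _).trans (e.symm_apply_apply_mk hy w)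
  have hinv : ∀ y ∈ e.baseSet, (A y).IsInvertible := by
    intro y hy
    refine isInvertible_of_forall_ne_zero fun v hv h0 ↦ hv ?_
    have h1 : e.symmL ℝ y v = 0 := inner_self_eq_zero.1 (show inner ℝ (s v y) (s v y) = 0 from h0)
    have h2 := e.continuousLinearMapAt_symmL (R := ℝ) hy v
    rw [← h2, h1, map_zero]
  have hcoord : (fun y ↦ (e ⟨y, σ y⟩).2) =ᶠ[𝓝 x] fun y ↦ (A y).inverse (l y) := by
    filter_upwards [hnhds] with y hy
    refine ((hinv y hy).inverse_apply_eq.2 ?_).symm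
    ext w
    exact congrArg (fun u : TangentSpace I y ↦ inner ℝ u (s w y)) (hse y hy (σ y)).symm
  refine (mdifferentiableAt_section I σ).2 (MDifferentiableAt.congr_of_eventuallyEq ?_ hcoord)
  refine MDifferentiableAt.clm_apply ?_ hl
  exact ((hinv x hmem).contDiffAt_map_inverse (n := 1)).contMDiffAt.mdifferentiableAt one_ne_zero
    |>.comp x hA

end Musical

/-! ### Horizontally conformal submersions and horizontal lifts -/

section HorizontallyConformal

variable {E : Type*} [NormedAddCommGroup E] [NormedSpace ℝ E] [FiniteDimensional ℝ E]
  {H : Type*} [TopologicalSpace H] {I : ModelWithCorners ℝ E H}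
  {M : Type*} [TopologicalSpace M] [ChartedSpace H M] [IsManifold I ∞ M]
  [RiemannianBundle (fun x : M ↦ TangentSpace I x)]
  [IsContMDiffRiemannianBundle I ∞ E (fun x : M ↦ TangentSpace I x)]
  {E' : Type*} [NormedAddCommGroup E'] [NormedSpace ℝ E'] [FiniteDimensional ℝ E']
  {H' : Type*} [TopologicalSpace H'] {J : ModelWithCorners ℝ E' H'}
  {N : Type*} [TopologicalSpace N] [ChartedSpace H' N] [IsManifold J ∞ N]
  [RiemannianBundle (fun y : N ↦ TangentSpace J y)]
  [IsContMDiffRiemannianBundle J ∞ E' (fun y : N ↦ TangentSpace J y)]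
  {f : M → N} {lam : M → ℝ} {x : M}

variable (I J) in
/-- The adjoint `T_{f x} N → T_x M` of the differential of `f` at `x`. -/
noncomputable def mfderivAdjoint (f : M → N) (x : M) :
    TangentSpace J (f x) →L[ℝ] TangentSpace I x :=
  ContinuousLinearMap.adjoint (mfderiv I J f x)

theorem inner_mfderivAdjoint_left (u : TangentSpace J (f x)) (v : TangentSpace I x) :
    inner ℝ (mfderivAdjoint I J f x u) v = inner ℝ u (mfderiv I J f x v) :=
  ContinuousLinearMap.adjoint_inner_left _ _ _

theorem inner_mfderivAdjoint_right (u : TangentSpace J (f x)) (v : TangentSpace I x) :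
    inner ℝ v (mfderivAdjoint I J f x u) = inner ℝ (mfderiv I J f x v) u :=
  ContinuousLinearMap.adjoint_inner_right _ _ _

theorem mem_verticalSpace {v : TangentSpace I x} :
    v ∈ verticalSpace I J f x ↔ mfderiv I J f x v = 0 :=
  LinearMap.mem_ker

theorem mfderivAdjoint_mem_horizontalSpace (u : TangentSpace J (f x)) :
    mfderivAdjoint I J f x u ∈ horizontalSpace I J f x := by
  refine (Submodule.mem_orthogonal' _ _).2 fun v hv ↦ ?_
  rw [inner_mfderivAdjoint_left, mem_verticalSpace.1 hv, inner_zero_right]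

theorem starProjection_add_starProjection (v : TangentSpace I x) :
    (verticalSpace I J f x).starProjection v + (horizontalSpace I J f x).starProjection v = v :=
  Submodule.starProjection_add_starProjection_orthogonal _

theorem mfderiv_starProjection_horizontalSpace (v : TangentSpace I x) :
    mfderiv I J f x ((horizontalSpace I J f x).starProjection v) = mfderiv I J f x v := by
  have h := congrArg (mfderiv I J f x) (starProjection_add_starProjection (J := J) (f := f) v)
  rwa [map_add, mem_verticalSpace.1 (Submodule.starProjection_apply_mem _ v), zero_add] at h

/-- If `σ` is a differentiable field along `f`, then `f_*ᵀ σ` is a differentiable vector field. -/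
theorem mdifferentiableAt_mfderivAdjoint (hf : ContMDiffAt I J 2 f x)
    {σ : Π y : M, TangentSpace J (f y)}
    (hσ : MDifferentiableAt I J.tangent (fun y ↦ (⟨f y, σ y⟩ : TangentBundle J N)) x) :
    MDiffAt (T% (fun y ↦ mfderivAdjoint I J f y (σ y))) x := by
  refine mdifferentiableAt_of_inner fun Z hZ ↦ ?_
  simp only [inner_mfderivAdjoint_left]
  exact MDifferentiableAt.inner_bundle (IB := J) (F := E')
    (E := fun y : N ↦ TangentSpace J y) (b := f) hσ (mdifferentiableAt_mfderiv_apply hf hZ)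

namespace IsHorizontallyConformalSubmersion

variable (hf : IsHorizontallyConformalSubmersion I J f lam)
include hf

theorem contMDiffAt_two : ContMDiffAt I J 2 f x :=
  (hf.contMDiff x).of_le (by norm_cast)

/-- Conformality: the differential composed with its adjoint is multiplication by `λ²`. -/
theorem mfderiv_mfderivAdjoint (u : TangentSpace J (f x)) :
    mfderiv I J f x (mfderivAdjoint I J f x u) = lam x ^ 2 • u := by
  refine ext_inner_right ℝ fun w ↦ ?_
  obtain ⟨v, rfl⟩ := hf.surjective_mfderiv x w
  rw [← mfderiv_starProjection_horizontalSpace (I := I) (J := J) v,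
    ← hf.conformal x _ (mfderivAdjoint_mem_horizontalSpace u) _
      (Submodule.starProjection_apply_mem _ v),
    inner_mfderivAdjoint_left, real_inner_smul_left]

/-- The horizontal projection is `λ⁻² f_*ᵀ f_*`. -/
theorem starProjection_horizontalSpace (v : TangentSpace I x) :
    (horizontalSpace I J f x).starProjection v =
      (lam x ^ 2)⁻¹ • mfderivAdjoint I J f x (mfderiv I J f x v) := by
  have h0 := pow_pos (hf.pos x) 2
  have hmem : mfderivAdjoint I J f x (mfderiv I J f x v) ∈ horizontalSpace I J f x :=
    mfderivAdjoint_mem_horizontalSpace _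
  refine (Submodule.eq_starProjection_of_mem_of_inner_eq_zero
    (Submodule.smul_mem _ _ hmem) fun w hw ↦ ?_)
  rw [inner_sub_left, real_inner_smul_left, inner_mfderivAdjoint_left,
    ← mfderiv_starProjection_horizontalSpace (I := I) (J := J) v,
    ← hf.conformal x _ (Submodule.starProjection_apply_mem _ v) w hw, inv_mul_cancel_left₀ h0.ne',
    ← inner_sub_left]
  exact Submodule.starProjection_inner_eq_zero v w hw

/-- The square of the dilation is differentiable: for a field `U` on the target that does not vanish
at `f x`, it is the quotient of `‖f_*ᵀ U‖²` by `‖U‖²` near `x`. -/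
theorem mdifferentiableAt_sq_dilation [Nontrivial E'] : MDiffAt (fun y ↦ lam y ^ 2) x := by
  obtain ⟨u, hu⟩ : ∃ u : TangentSpace J (f x), u ≠ 0 := exists_ne (0 : E')
  let U : Π y : N, TangentSpace J y := FiberBundle.extend E' u
  have hU : MDiffAt (T% U) (f x) := FiberBundle.mdifferentiableAt_extend ..
  have hUf : MDifferentiableAt I J.tangent (fun y ↦ (⟨f y, U (f y)⟩ : TangentBundle J N)) x :=
    hU.comp x (hf.contMDiffAt_two.mdifferentiableAt two_ne_zero)
  have h1 := mdifferentiableAt_mfderivAdjoint hf.contMDiffAt_two hUf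
  have h2 : MDiffAt (fun y ↦ inner ℝ (U (f y)) (U (f y))) x :=
    MDifferentiableAt.inner_bundle (IB := J) (F := E')
      (E := fun y : N ↦ TangentSpace J y) (b := f) hUf hUf
  have h3 := inner_mdifferentiableAt h1 h1
  have h0 : inner ℝ (U (f x)) (U (f x)) ≠ (0 : ℝ) := by
    refine inner_self_ne_zero.2 ?_
    simpa [U] using hu
  have hev := h2.continuousAt.eventually_ne h0
  have h4 : MDiffAt (fun y ↦ (inner ℝ (U (f y)) (U (f y)))⁻¹ * inner ℝ
      (mfderivAdjoint I J f y (U (f y))) (mfderivAdjoint I J f y (U (f y)))) x :=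
    ((differentiableAt_inv h0).mdifferentiableAt.comp x h2).mul h3
  refine h4.congr_of_eventuallyEq ?_
  filter_upwards [hev] with y hy
  rw [inner_mfderivAdjoint_left, hf.mfderiv_mfderivAdjoint, real_inner_smul_right]
  field_simp

variable [Nontrivial E']

theorem mdifferentiableAt_inv_sq_dilation : MDiffAt (fun y ↦ (lam y ^ 2)⁻¹) x :=
  (differentiableAt_inv (pow_pos (hf.pos x) 2).ne').mdifferentiableAt.comp x
    hf.mdifferentiableAt_sq_dilation

/-- `d(λ⁻²) = -2 λ⁻² d(ln λ)`. -/
theorem mvfderiv_inv_sq_dilation (v : TangentSpace I x) :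
    mvfderiv I (fun y ↦ (lam y ^ 2)⁻¹) x v =
      -2 * (lam x ^ 2)⁻¹ * mvfderiv I (fun y ↦ Real.log (lam y)) x v := by
  have hpos := hf.pos x
  have h1 := hf.mdifferentiableAt_inv_sq_dilation (x := x)
  have hne : (lam x ^ 2)⁻¹ ≠ 0 := by positivity
  -- the logarithm is differentiated through `ln λ = -(1/2) ln (λ⁻²)`
  have hlog : (fun y ↦ Real.log (lam y)) =
      (fun t ↦ (-1 / 2 : ℝ) * Real.log t) ∘ fun y ↦ (lam y ^ 2)⁻¹ := by
    funext y
    simp only [Function.comp_apply, Real.log_inv, Real.log_pow]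
    push_cast
    ring
  have hd : HasDerivAt (fun t ↦ (-1 / 2 : ℝ) * Real.log t) ((-1 / 2) * ((lam x ^ 2)⁻¹)⁻¹)
      ((lam x ^ 2)⁻¹) := (Real.hasDerivAt_log hne).const_mul _
  rw [hlog, mvfderiv_comp_apply x hd.differentiableAt.mdifferentiableAt h1]
  have h2 : mvfderiv 𝓘(ℝ, ℝ) (fun t ↦ (-1 / 2 : ℝ) * Real.log t) ((lam x ^ 2)⁻¹) =
      fderiv ℝ (fun t ↦ (-1 / 2 : ℝ) * Real.log t) ((lam x ^ 2)⁻¹) := mfderiv_eq_fderiv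
  have h3 : ∀ t : ℝ, mvfderiv 𝓘(ℝ, ℝ) (fun t ↦ (-1 / 2 : ℝ) * Real.log t) ((lam x ^ 2)⁻¹) t =
      (-1 / 2) * ((lam x ^ 2)⁻¹)⁻¹ * t := fun t ↦ by
    
    rw [h2, hd.hasFDerivAt.fderiv]
    exact mul_comm _ _
  refine Eq.trans ?_ (congrArg _ (h3 (mvfderiv I (fun y ↦ (lam y ^ 2)⁻¹) x v)).symm)
  field_simp

theorem mdifferentiableAt_horizontalPart {X : Π y : M, TangentSpace I y} (hX : MDiffAt (T% X) x) :
    MDiffAt (T% (horizontalPart I J f X)) x := by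
  have h : horizontalPart I J f X = (fun y ↦ (lam y ^ 2)⁻¹) •
      fun y ↦ mfderivAdjoint I J f y (mfderiv I J f y (X y)) :=
    funext fun y ↦ hf.starProjection_horizontalSpace (X y)
  rw [h]
  exact hf.mdifferentiableAt_inv_sq_dilation.smul_section
    (mdifferentiableAt_mfderivAdjoint hf.contMDiffAt_two
      (mdifferentiableAt_mfderiv_apply hf.contMDiffAt_two hX))

theorem mdifferentiableAt_verticalPart {X : Π y : M, TangentSpace I y} (hX : MDiffAt (T% X) x) :
    MDiffAt (T% (verticalPart I J f X)) x := by
  have h : verticalPart I J f X = X - horizontalPart I J f X :=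
    funext fun y ↦ eq_sub_of_add_eq (starProjection_add_starProjection (X y))
  rw [h]
  exact mdifferentiableAt_sub_section hX (hf.mdifferentiableAt_horizontalPart hX)

end IsHorizontallyConformalSubmersion

variable (I J) in
/-- The horizontal lift `λ⁻² f_*ᵀ W` of a vector field `W` on the target of a horizontally conformal
submersion `f` with dilation `lam`. -/
noncomputable def horizontalLift (f : M → N) (lam : M → ℝ) (W : Π y : N, TangentSpace J y)
    (x : M) : TangentSpace I x :=
  (lam x ^ 2)⁻¹ • mfderivAdjoint I J f x (W (f x))

theorem inner_horizontalLift_left (W : Π y : N, TangentSpace J y) (v : TangentSpace I x) :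
    inner ℝ (horizontalLift I J f lam W x) v =
      (lam x ^ 2)⁻¹ * inner ℝ (W (f x)) (mfderiv I J f x v) := by
  rw [horizontalLift, real_inner_smul_left, inner_mfderivAdjoint_left]

namespace IsHorizontallyConformalSubmersion

variable (hf : IsHorizontallyConformalSubmersion I J f lam)
include hf

theorem mfderiv_horizontalLift (W : Π y : N, TangentSpace J y) :
    mfderiv I J f x (horizontalLift I J f lam W x) = W (f x) := by
  rw [horizontalLift, map_smul, hf.mfderiv_mfderivAdjoint,
    inv_smul_smul₀ (pow_pos (hf.pos x) 2).ne']

theorem mdifferentiableAt_horizontalLift [Nontrivial E'] {W : Π y : N, TangentSpace J y}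
    (hW : MDiffAt (T% W) (f x)) : MDiffAt (T% (horizontalLift I J f lam W)) x :=
  hf.mdifferentiableAt_inv_sq_dilation.smul_section
    (mdifferentiableAt_mfderivAdjoint hf.contMDiffAt_two
      (hW.comp x (hf.contMDiffAt_two.mdifferentiableAt two_ne_zero)))

end IsHorizontallyConformalSubmersion

end HorizontallyConformal

/-! ### Tensoriality of the second fundamental form -/

section SecondFundamentalForm

variable {E : Type*} [NormedAddCommGroup E] [NormedSpace ℝ E] [FiniteDimensional ℝ E]
  {H : Type*} [TopologicalSpace H] {I : ModelWithCorners ℝ E H}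
  {M : Type*} [TopologicalSpace M] [ChartedSpace H M] [IsManifold I ∞ M]
  [RiemannianBundle (fun x : M ↦ TangentSpace I x)]
  [IsContMDiffRiemannianBundle I ∞ E (fun x : M ↦ TangentSpace I x)]
  {E' : Type*} [NormedAddCommGroup E'] [NormedSpace ℝ E'] [FiniteDimensional ℝ E']
  {H' : Type*} [TopologicalSpace H'] {J : ModelWithCorners ℝ E' H'}
  {N : Type*} [TopologicalSpace N] [ChartedSpace H' N] [IsManifold J ∞ N]
  [RiemannianBundle (fun y : N ↦ TangentSpace J y)]
  [IsContMDiffRiemannianBundle J ∞ E' (fun y : N ↦ TangentSpace J y)]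
  {f : M → N} {x : M}

/-- The covariant derivative at `y` of the extension of `u ∈ T_y N` with constant coordinates is
additive in `u`, because the extension is so near `y`. -/
theorem leviCivita_extend_add {y : N} (u v : TangentSpace J y) :
    leviCivita J N (FiberBundle.extend E' (u + v)) y =
      leviCivita J N (FiberBundle.extend E' u) y + leviCivita J N (FiberBundle.extend E' v) y := by
  set e := trivializationAt E' (fun y : N ↦ TangentSpace J y) y with he
  have hmem : y ∈ e.baseSet := FiberBundle.mem_baseSet_trivializationAt' y
  have hu := FiberBundle.mdifferentiableAt_extend J E' u
  have hv := FiberBundle.mdifferentiableAt_extend J E' v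
  have hlin : (e ⟨y, u + v⟩).2 = (e ⟨y, u⟩).2 + (e ⟨y, v⟩).2 := (e.linear ℝ hmem).map_add u v
  have hev : (FiberBundle.extend E' (u + v) : Π z : N, TangentSpace J z) =ᶠ[𝓝 y]
      FiberBundle.extend E' u + FiberBundle.extend E' v := by
    filter_upwards [e.open_baseSet.mem_nhds hmem] with z hz
    simp only [FiberBundle.extend, ← he, Pi.add_apply, hlin]
    have h := map_add (e.symmL ℝ z) (e ⟨y, u⟩).2 (e ⟨y, v⟩).2
    simp only [e.symmL_apply (R := ℝ) hz] at h
    exact h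
  exact ((leviCivita J N).isCovariantDerivativeOnUniv.congr_of_eventuallyEq
    (FiberBundle.mdifferentiableAt_extend J E' (u + v)) (mdifferentiableAt_add_section hu hv)
    Filter.univ_mem hev).trans
    ((leviCivita J N).isCovariantDerivativeOnUniv.add hu hv (Set.mem_univ y))

theorem leviCivita_extend_smul {y : N} (c : ℝ) (u : TangentSpace J y) :
    leviCivita J N (FiberBundle.extend E' (c • u)) y =
      c • leviCivita J N (FiberBundle.extend E' u) y := by
  set e := trivializationAt E' (fun y : N ↦ TangentSpace J y) y with he
  have hmem : y ∈ e.baseSet := FiberBundle.mem_baseSet_trivializationAt' y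
  have hu := FiberBundle.mdifferentiableAt_extend J E' u
  have hc : MDiffAt (fun _ : N ↦ c) y := mdifferentiableAt_const
  have hlin : (e ⟨y, c • u⟩).2 = c • (e ⟨y, u⟩).2 := (e.linear ℝ hmem).map_smul c u
  have hev : (FiberBundle.extend E' (c • u) : Π z : N, TangentSpace J z) =ᶠ[𝓝 y]
      (fun _ : N ↦ c) • FiberBundle.extend E' u := by
    filter_upwards [e.open_baseSet.mem_nhds hmem] with z hz
    simp only [FiberBundle.extend, ← he, Pi.smul_apply', hlin]
    have h := map_smul (e.symmL ℝ z) c (e ⟨y, u⟩).2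
    simp only [e.symmL_apply (R := ℝ) hz] at h
    exact h
  refine ((leviCivita J N).isCovariantDerivativeOnUniv.congr_of_eventuallyEq
    (FiberBundle.mdifferentiableAt_extend J E' (c • u)) (hc.smul_section hu)
    Filter.univ_mem hev).trans ?_
  refine ((leviCivita J N).isCovariantDerivativeOnUniv.leibniz hu hc (Set.mem_univ y)).trans ?_
  ext v
  simp [mvfderiv_const]

theorem symmL_trivializationAt_apply {y : N} (w : TangentSpace J y) :
    (trivializationAt E' (fun y : N ↦ TangentSpace J y) y).symmL ℝ y
      ((trivializationAt E' (fun y : N ↦ TangentSpace J y) y) ⟨y, w⟩).2 = w :=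
  (Trivialization.symmL_apply (R := ℝ) _ (FiberBundle.mem_baseSet_trivializationAt' y) _).trans
    (Trivialization.symm_apply_apply_mk _ (FiberBundle.mem_baseSet_trivializationAt' y) w)

variable {σ σ' : Π y : M, TangentSpace J (f y)}

theorem pullbackConnection_add
    (hσ : MDifferentiableAt I J.tangent (fun y ↦ (⟨f y, σ y⟩ : TangentBundle J N)) x)
    (hσ' : MDifferentiableAt I J.tangent (fun y ↦ (⟨f y, σ' y⟩ : TangentBundle J N)) x)
    (v : TangentSpace I x) :
    pullbackConnection I J f (fun y ↦ σ y + σ' y) x v =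
      pullbackConnection I J f σ x v + pullbackConnection I J f σ' x v := by
  have h1 := (mdifferentiableAt_totalSpace J _).1 hσ
  have h2 := (mdifferentiableAt_totalSpace J _).1 hσ'
  set e := trivializationAt E' (fun y : N ↦ TangentSpace J y) (f x) with he
  have hnhds : ∀ᶠ y in 𝓝 x, f y ∈ e.baseSet := h1.1.continuousAt.eventually
    (e.open_baseSet.mem_nhds (FiberBundle.mem_baseSet_trivializationAt' (f x)))
  have h3 : (fun y ↦ (e ⟨f y, σ y + σ' y⟩).2) =ᶠ[𝓝 x]
      fun y ↦ (e ⟨f y, σ y⟩).2 + (e ⟨f y, σ' y⟩).2 := by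
    filter_upwards [hnhds] with y hy
    exact (e.linear ℝ hy).map_add (σ y) (σ' y)
  have h5 := mvfderiv_fun_add h1.2 h2.2
  simp only [pullbackConnection, ← he, mvfderiv_congr_of_eventuallyEq h3, leviCivita_extend_add]
  rw [h5]
  simp only [add_apply, ContinuousLinearMap.comp_apply, map_add]
  abel

/-- The Leibniz rule for the pullback connection. -/
theorem pullbackConnection_smul {g : M → ℝ} (hg : MDiffAt g x)
    (hσ : MDifferentiableAt I J.tangent (fun y ↦ (⟨f y, σ y⟩ : TangentBundle J N)) x)
    (v : TangentSpace I x) :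
    pullbackConnection I J f (fun y ↦ g y • σ y) x v =
      g x • pullbackConnection I J f σ x v + mvfderiv I g x v • σ x := by
  have h1 := (mdifferentiableAt_totalSpace J _).1 hσ
  set e := trivializationAt E' (fun y : N ↦ TangentSpace J y) (f x) with he
  have hnhds : ∀ᶠ y in 𝓝 x, f y ∈ e.baseSet := h1.1.continuousAt.eventually
    (e.open_baseSet.mem_nhds (FiberBundle.mem_baseSet_trivializationAt' (f x)))
  have h3 : (fun y ↦ (e ⟨f y, g y • σ y⟩).2) =ᶠ[𝓝 x] fun y ↦ g y • (e ⟨f y, σ y⟩).2 := by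
    filter_upwards [hnhds] with y hy
    exact (e.linear ℝ hy).map_smul (g y) (σ y)
  have h5 := mvfderiv_fun_smul hg h1.2
  simp only [pullbackConnection, ← he, mvfderiv_congr_of_eventuallyEq h3, leviCivita_extend_smul]
  rw [h5]
  simp only [add_apply, ContinuousLinearMap.comp_apply, map_add,
    smul_apply, ContinuousLinearMap.smulRight_apply, map_smul, he, symmL_trivializationAt_apply]
  module

theorem pullbackConnection_zero (hf : MDiffAt f x) (v : TangentSpace I x) :
    pullbackConnection I J f (fun y ↦ (0 : TangentSpace J (f y))) x v = 0 := by
  have h0 : MDifferentiableAt I J.tangent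
      (fun y ↦ (⟨f y, 0⟩ : TangentBundle J N)) x :=
    MDifferentiableAt.comp x (g := zeroSection E' (fun y : N ↦ TangentSpace J y))
      (mdifferentiableAt_zeroSection ℝ _) hf
  have h := pullbackConnection_add h0 h0 v
  simpa using h

theorem secondFundamentalForm_tensorial_left (Y : Π y : M, TangentSpace I y) :
    TensorialAt I E (fun X ↦ secondFundamentalForm I J f X Y x) x where
  smul _ _ := by simp [secondFundamentalForm, smul_sub]
  add _ _ := by
    simp only [secondFundamentalForm, Pi.add_apply, map_add]
    abel

theorem secondFundamentalForm_tensorial_right (hf : ContMDiffAt I J 2 f x)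
    (X : Π y : M, TangentSpace I y) :
    TensorialAt I E (fun Y ↦ secondFundamentalForm I J f X Y x) x where
  smul {g Y} hg hY := by
    have h1 := pullbackConnection_smul hg (mdifferentiableAt_mfderiv_apply hf hY) (X x)
    have h2 := (leviCivita I M).isCovariantDerivativeOnUniv.leibniz hY hg (Set.mem_univ x)
    simp only [secondFundamentalForm, Pi.smul_apply', map_smul, h1, h2]
    simp only [add_apply, smul_apply,
      ContinuousLinearMap.smulRight_apply, map_add, map_smul]
    module
  add {Y Y'} hY hY' := by
    have h1 := pullbackConnection_add (mdifferentiableAt_mfderiv_apply hf hY)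
      (mdifferentiableAt_mfderiv_apply hf hY') (X x)
    have h2 := (leviCivita I M).isCovariantDerivativeOnUniv.add hY hY' (Set.mem_univ x)
    simp only [secondFundamentalForm, Pi.add_apply, map_add, h1, h2]
    simp only [add_apply, map_add]
    abel

/-- The second fundamental form of `f` at `x`, as a bilinear map on `T_x M`. -/
noncomputable def secondFundamentalFormAt (hf : ContMDiffAt I J 2 f x) :
    TangentSpace I x →L[ℝ] TangentSpace I x →L[ℝ] TangentSpace J (f x) :=
  TensorialAt.mkHom₂ (fun X Y ↦ secondFundamentalForm I J f X Y x) x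
    (fun Y _ ↦ secondFundamentalForm_tensorial_left Y)
    (fun X _ ↦ secondFundamentalForm_tensorial_right hf X)

theorem secondFundamentalFormAt_apply (hf : ContMDiffAt I J 2 f x)
    {X Y : Π y : M, TangentSpace I y} (hX : MDiffAt (T% X) x) (hY : MDiffAt (T% Y) x) :
    secondFundamentalFormAt hf (X x) (Y x) = secondFundamentalForm I J f X Y x :=
  TensorialAt.mkHom₂_apply (Φ := fun X Y ↦ secondFundamentalForm I J f X Y x)
    (fun Y _ ↦ secondFundamentalForm_tensorial_left Y)
    (fun X _ ↦ secondFundamentalForm_tensorial_right hf X) hX hY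

theorem tensionField_eq_sum (hf : ContMDiffAt I J 2 f x) :
    tensionField I J f x = ∑ i, secondFundamentalFormAt hf
      (stdOrthonormalBasis ℝ (TangentSpace I x) i) (stdOrthonormalBasis ℝ (TangentSpace I x) i) :=
  rfl

end SecondFundamentalForm

section Trace

variable {V W : Type*} [NormedAddCommGroup V] [InnerProductSpace ℝ V] [AddCommGroup W] [Module ℝ W]
  {ι κ : Type*} [Fintype ι] [Fintype κ]

/-- The trace of a bilinear map over a subspace `K`, computed with an orthonormal basis of the whole
space. -/
theorem sum_bilin_starProjection (b : V →ₗ[ℝ] V →ₗ[ℝ] W) (e : OrthonormalBasis ι ℝ V)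
    (K : Submodule ℝ V) [K.HasOrthogonalProjection] (v : OrthonormalBasis κ ℝ K) :
    ∑ i, b (e i) (K.starProjection (e i)) = ∑ j, b (v j) (v j) := by
  have h : ∀ i, K.starProjection (e i) = ∑ j, inner ℝ (v j : V) (e i) • (v j : V) := by
    intro i
    have := congrArg (fun u : K ↦ (u : V)) (v.sum_repr' (K.orthogonalProjectionOnto (e i)))
    simp only [Submodule.coe_sum, Submodule.coe_smul] at this
    rw [Submodule.starProjection_apply, ← this]
    refine Finset.sum_congr rfl fun j _ ↦ ?_
    rw [Submodule.inner_orthogonalProjectionOnto_eq_of_mem_left]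
  simp only [h, map_sum, map_smul]
  rw [Finset.sum_comm]
  refine Finset.sum_congr rfl fun j _ ↦ ?_
  calc ∑ i, inner ℝ (v j : V) (e i) • b (e i) (v j : V)
      = b (∑ i, inner ℝ (e i) (v j : V) • e i) (v j) := by
        simp only [map_sum, map_smul, LinearMap.sum_apply, LinearMap.smul_apply, real_inner_comm]
    _ = b (v j) (v j) := by rw [e.sum_repr']

end Trace

/-! ### The tension field -/

section Tension

variable {E : Type*} [NormedAddCommGroup E] [NormedSpace ℝ E] [FiniteDimensional ℝ E]
  {H : Type*} [TopologicalSpace H] {I : ModelWithCorners ℝ E H}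
  {M : Type*} [TopologicalSpace M] [ChartedSpace H M] [IsManifold I ∞ M]
  [RiemannianBundle (fun x : M ↦ TangentSpace I x)]
  [IsContMDiffRiemannianBundle I ∞ E (fun x : M ↦ TangentSpace I x)]
  {E' : Type*} [NormedAddCommGroup E'] [NormedSpace ℝ E'] [FiniteDimensional ℝ E']
  {H' : Type*} [TopologicalSpace H'] {J : ModelWithCorners ℝ E' H'}
  {N : Type*} [TopologicalSpace N] [ChartedSpace H' N] [IsManifold J ∞ N]
  [RiemannianBundle (fun y : N ↦ TangentSpace J y)]
  [IsContMDiffRiemannianBundle J ∞ E' (fun y : N ↦ TangentSpace J y)]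
  {f : M → N} {lam : M → ℝ} {x : M}

theorem inner_riemannianGradient_left (u : M → ℝ) (v : TangentSpace I x) :
    inner ℝ (riemannianGradient I u x) v = mvfderiv I u x v :=
  InnerProductSpace.toDual_symm_apply

namespace IsHorizontallyConformalSubmersion

variable [Nontrivial E'] (hf : IsHorizontallyConformalSubmersion I J f lam)
include hf

/-- On vertical vectors the second fundamental form of `f` is minus the image of that of the
fibres. -/
theorem secondFundamentalFormAt_vertical {v : TangentSpace I x} (hv : v ∈ verticalSpace I J f x) :
    secondFundamentalFormAt hf.contMDiffAt_two v v =
      -mfderiv I J f x (verticalSecondFundamentalForm I J f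
        (verticalPart I J f (FiberBundle.extend E v))
        (verticalPart I J f (FiberBundle.extend E v)) x) := by
  set V := verticalPart I J f (FiberBundle.extend E v) with hV
  have hVd : MDiffAt (T% V) x :=
    hf.mdifferentiableAt_verticalPart (FiberBundle.mdifferentiableAt_extend ..)
  have hVx : V x = v := by
    rw [hV, verticalPart, FiberBundle.extend_apply_self]
    exact Submodule.starProjection_eq_self_iff.2 hv
  have hfV : (fun y ↦ mfderiv I J f y (V y)) = fun y ↦ (0 : TangentSpace J (f y)) :=
    funext fun y ↦ mem_verticalSpace.1 (Submodule.starProjection_apply_mem _ _)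
  have h := secondFundamentalFormAt_apply hf.contMDiffAt_two hVd hVd
  rw [hVx] at h
  rw [h, secondFundamentalForm, hfV,
    pullbackConnection_zero (hf.contMDiffAt_two.mdifferentiableAt two_ne_zero), zero_sub,
    verticalSecondFundamentalForm, horizontalPart, mfderiv_starProjection_horizontalSpace]

/-- The metric of `M` on horizontal lifts. -/
theorem inner_horizontalLift_horizontalLift (V W : Π y : N, TangentSpace J y) :
    inner ℝ (horizontalLift I J f lam V x) (horizontalLift I J f lam W x) =
      (lam x ^ 2)⁻¹ * inner ℝ (V (f x)) (W (f x)) := by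
  rw [inner_horizontalLift_left, hf.mfderiv_horizontalLift]

theorem mvfderiv_inner_horizontalLift {V W : Π y : N, TangentSpace J y}
    (hV : MDiffAt (T% V) (f x)) (hW : MDiffAt (T% W) (f x)) (v : TangentSpace I x) :
    mvfderiv I (fun y ↦ inner ℝ (horizontalLift I J f lam V y) (horizontalLift I J f lam W y)) x v =
      (lam x ^ 2)⁻¹ * (mvfderiv J (fun y ↦ inner ℝ (V y) (W y)) (f x) (mfderiv I J f x v) -
        2 * mvfderiv I (fun y ↦ Real.log (lam y)) x v * inner ℝ (V (f x)) (W (f x))) := by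
  have hfx := hf.contMDiffAt_two.mdifferentiableAt two_ne_zero (x := x)
  have h1 := inner_mdifferentiableAt hV hW
  have h2 := mvfderiv_fun_mul hf.mdifferentiableAt_inv_sq_dilation (h1.comp x hfx)
  have h3 := mvfderiv_comp_apply x h1 hfx v
  have h4 := hf.mvfderiv_inv_sq_dilation v
  simp only [hf.inner_horizontalLift_horizontalLift]
  refine (congrArg (fun A : TangentSpace I x →L[ℝ] ℝ ↦ A v) h2).trans ?_
  simp only [add_apply, smul_apply, smul_eq_mul, h3, h4, Function.comp_apply]
  ring

/-- The Koszul expressions of two fields on `N` and of their horizontal lifts differ only by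
derivatives of `ln λ`. -/
theorem koszul_horizontalLift [I.Boundaryless] [J.Boundaryless] {W W' : Π y : N, TangentSpace J y}
    (hW : MDiffAt (T% W) (f x)) (hW' : MDiffAt (T% W') (f x)) :
    lam x ^ 2 * koszul I (horizontalLift I J f lam W) (horizontalLift I J f lam W)
        (horizontalLift I J f lam W') x =
      koszul J W W W' (f x)
        - 4 * mvfderiv I (fun y ↦ Real.log (lam y)) x (horizontalLift I J f lam W x)
          * inner ℝ (W (f x)) (W' (f x))
        + 2 * mvfderiv I (fun y ↦ Real.log (lam y)) x (horizontalLift I J f lam W' x)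
          * inner ℝ (W (f x)) (W (f x)) := by
  have h0 := (hf.pos x).ne'
  have hbr : ∀ {V V' : Π y : N, TangentSpace J y}, MDiffAt (T% V) (f x) → MDiffAt (T% V') (f x) →
      ∀ U : Π y : N, TangentSpace J y,
      inner ℝ (VectorField.mlieBracket I (horizontalLift I J f lam V)
        (horizontalLift I J f lam V') x) (horizontalLift I J f lam U x) =
      (lam x ^ 2)⁻¹ * inner ℝ (VectorField.mlieBracket J V V' (f x)) (U (f x)) := by
    intro V V' hV hV' U
    rw [real_inner_comm, inner_horizontalLift_left, mfderiv_mlieBracket_of_related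
      hf.contMDiffAt_two (hf.mdifferentiableAt_horizontalLift hV)
      (hf.mdifferentiableAt_horizontalLift hV') hV hV'
      (.of_forall fun y ↦ hf.mfderiv_horizontalLift V)
      (.of_forall fun y ↦ hf.mfderiv_horizontalLift V'), real_inner_comm]
  simp only [koszul, hf.mvfderiv_inner_horizontalLift hW hW,
    hf.mvfderiv_inner_horizontalLift hW hW', hbr hW hW, hbr hW hW', hf.mfderiv_horizontalLift]
  field_simp
  ring

/-- On horizontal vectors the second fundamental form of `f` is determined by the gradient of the
logarithm of the dilation. -/
theorem secondFundamentalFormAt_horizontal [I.Boundaryless] [J.Boundaryless] {h : TangentSpace I x}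
    (hh : h ∈ horizontalSpace I J f x) :
    secondFundamentalFormAt hf.contMDiffAt_two h h =
      (2 * mvfderiv I (fun y ↦ Real.log (lam y)) x h) • mfderiv I J f x h
        - inner ℝ h h • mfderiv I J f x (riemannianGradient I (fun y ↦ Real.log (lam y)) x) := by
  have hpos := pow_pos (hf.pos x) 2
  refine ext_inner_right ℝ fun w ↦ ?_
  let W : Π y : N, TangentSpace J y := FiberBundle.extend E' (mfderiv I J f x h)
  let W' : Π y : N, TangentSpace J y := FiberBundle.extend E' w
  have hW : MDiffAt (T% W) (f x) := FiberBundle.mdifferentiableAt_extend ..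
  have hW' : MDiffAt (T% W') (f x) := FiberBundle.mdifferentiableAt_extend ..
  have hWx : W (f x) = mfderiv I J f x h := FiberBundle.extend_apply_self _ _
  have hWx' : W' (f x) = w := FiberBundle.extend_apply_self _ _
  have hX := hf.mdifferentiableAt_horizontalLift hW
  have hZ := hf.mdifferentiableAt_horizontalLift hW'
  have hXx : horizontalLift I J f lam W x = h := by
    rw [horizontalLift, hWx, ← hf.starProjection_horizontalSpace]
    exact Submodule.starProjection_eq_self_iff.2 hh
  have hB := secondFundamentalFormAt_apply hf.contMDiffAt_two hX hX
  have hfX : (fun y ↦ mfderiv I J f y (horizontalLift I J f lam W y)) = fun y ↦ W (f y) :=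
    funext fun y ↦ hf.mfderiv_horizontalLift W
  rw [secondFundamentalForm, hfX,
    pullbackConnection_comp (hf.contMDiffAt_two.mdifferentiableAt two_ne_zero) hW,
    hf.mfderiv_horizontalLift] at hB
  have hN := inner_leviCivita hW hW hW'
  have hM := inner_leviCivita hX hX hZ
  rw [real_inner_comm, inner_horizontalLift_left, real_inner_comm] at hM
  have hK := hf.koszul_horizontalLift hW hW'
  have hgrad : inner ℝ (mfderiv I J f x (riemannianGradient I (fun y ↦ Real.log (lam y)) x)) w =
      lam x ^ 2 * mvfderiv I (fun y ↦ Real.log (lam y)) x (horizontalLift I J f lam W' x) := by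
    rw [← inner_mfderivAdjoint_right, inner_riemannianGradient_left, horizontalLift, map_smul,
      hWx', smul_eq_mul, mul_inv_cancel_left₀ hpos.ne']
  have hnorm := hf.conformal x h hh h hh
  rw [hXx, hWx'] at *
  rw [hWx] at *
  rw [hB, inner_sub_left, inner_sub_left, real_inner_smul_left, real_inner_smul_left, hN, hgrad]
  rw [← hnorm] at hK
  have hM' : inner ℝ (mfderiv I J f x (leviCivita I M (horizontalLift I J f lam W) x h)) w =
      1 / 2 * (lam x ^ 2 * koszul I (horizontalLift I J f lam W) (horizontalLift I J f lam W)
        (horizontalLift I J f lam W') x) := by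
    rw [mul_left_comm, ← hM, mul_inv_cancel_left₀ hpos.ne']
  rw [hM', hK]
  ring

omit [Nontrivial E'] in
theorem finrank_horizontalSpace :
    Module.finrank ℝ (horizontalSpace I J f x) = Module.finrank ℝ E' := by
  have h1 := Submodule.finrank_add_finrank_orthogonal (verticalSpace I J f x)
  have h2 := LinearMap.finrank_range_add_finrank_ker
    (mfderiv I J f x : TangentSpace I x →ₗ[ℝ] TangentSpace J (f x))
  rw [LinearMap.range_eq_top.2 (hf.surjective_mfderiv x), finrank_top] at h2
  have h3 : Module.finrank ℝ (TangentSpace J (f x)) = Module.finrank ℝ E' := rfl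
  have h4 : Module.finrank ℝ (verticalSpace I J f x) = Module.finrank ℝ (LinearMap.ker
    (mfderiv I J f x : TangentSpace I x →ₗ[ℝ] TangentSpace J (f x))) := rfl
  rw [horizontalSpace]
  omega

omit [Nontrivial E'] in
theorem finrank_verticalSpace_add :
    Module.finrank ℝ (verticalSpace I J f x) + Module.finrank ℝ E' = Module.finrank ℝ E := by
  rw [← hf.finrank_horizontalSpace (x := x)]
  exact Submodule.finrank_add_finrank_orthogonal (verticalSpace I J f x)

theorem sum_secondFundamentalFormAt_vertical :
    ∑ j, secondFundamentalFormAt hf.contMDiffAt_two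
        (stdOrthonormalBasis ℝ (verticalSpace I J f x) j : TangentSpace I x)
        (stdOrthonormalBasis ℝ (verticalSpace I J f x) j : TangentSpace I x) =
      -(Module.finrank ℝ (verticalSpace I J f x) : ℝ) •
        mfderiv I J f x (verticalMeanCurvature I J f x) := by
  simp only [fun j ↦ hf.secondFundamentalFormAt_vertical
    (stdOrthonormalBasis ℝ (verticalSpace I J f x) j).2, Finset.sum_neg_distrib, ← map_sum]
  rw [verticalMeanCurvature, map_smul, neg_smul, neg_inj]
  rcases eq_or_ne (Module.finrank ℝ (verticalSpace I J f x)) 0 with h0 | h0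
  -- the normalization `0⁻¹ = 0` is harmless: the sum is empty
  · have : IsEmpty (Fin (Module.finrank ℝ (verticalSpace I J f x))) := by
      rw [h0]; infer_instance
    simp
  · rw [smul_inv_smul₀ (Nat.cast_ne_zero.2 h0)]

theorem sum_secondFundamentalFormAt_horizontal [I.Boundaryless] [J.Boundaryless] :
    ∑ k, secondFundamentalFormAt hf.contMDiffAt_two
        (stdOrthonormalBasis ℝ (horizontalSpace I J f x) k : TangentSpace I x)
        (stdOrthonormalBasis ℝ (horizontalSpace I J f x) k : TangentSpace I x) =
      (2 - (Module.finrank ℝ E' : ℝ)) •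
        mfderiv I J f x (riemannianGradient I (fun y ↦ Real.log (lam y)) x) := by
  set G := riemannianGradient I (fun y ↦ Real.log (lam y)) x with hG
  set b := stdOrthonormalBasis ℝ (horizontalSpace I J f x)
  have hproj : ∑ k, mvfderiv I (fun y ↦ Real.log (lam y)) x (b k) • (b k : TangentSpace I x) =
      (horizontalSpace I J f x).starProjection G := by
    have h1 := congrArg (fun u : horizontalSpace I J f x ↦ (u : TangentSpace I x))
      (b.sum_repr' ((horizontalSpace I J f x).orthogonalProjectionOnto G))
    simp only [Submodule.coe_sum, Submodule.coe_smul] at h1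
    rw [Submodule.starProjection_apply, ← h1]
    refine Finset.sum_congr rfl fun k _ ↦ ?_
    rw [Submodule.inner_orthogonalProjectionOnto_eq_of_mem_left, real_inner_comm, hG,
      inner_riemannianGradient_left]
  have hunit : ∀ k, inner ℝ (b k : TangentSpace I x) (b k : TangentSpace I x) = (1 : ℝ) := by
    intro k
    have h1 : inner ℝ (b k) (b k) = (1 : ℝ) := by
      rw [real_inner_self_eq_norm_sq, b.orthonormal.1 k, one_pow]
    exact h1
  have hsum : ∑ k, mvfderiv I (fun y ↦ Real.log (lam y)) x (b k) • mfderiv I J f x (b k) =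
      mfderiv I J f x G := by
    rw [← mfderiv_starProjection_horizontalSpace G, ← hproj, map_sum]
    simp only [map_smul]
  simp only [fun k ↦ hf.secondFundamentalFormAt_horizontal (b k).2, Finset.sum_sub_distrib, hunit,
    one_smul, mul_smul, ← Finset.smul_sum, hsum]
  rw [Finset.sum_const, Finset.card_univ, Fintype.card_fin, hf.finrank_horizontalSpace, sub_smul,
    Nat.cast_smul_eq_nsmul]

/-- The tension field of a horizontally conformal submersion `f` is
`-r f_* μ + (2 - dim N) f_* grad (ln λ)`, where `r` is the dimension of the fibres. -/
theorem tensionField_eq [I.Boundaryless] [J.Boundaryless] :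
    tensionField I J f x =
      -(Module.finrank ℝ (verticalSpace I J f x) : ℝ) •
          mfderiv I J f x (verticalMeanCurvature I J f x) +
        (2 - (Module.finrank ℝ E' : ℝ)) •
          mfderiv I J f x (riemannianGradient I (fun y ↦ Real.log (lam y)) x) := by
  let B : TangentSpace I x →ₗ[ℝ] TangentSpace I x →ₗ[ℝ] TangentSpace J (f x) :=
    LinearMap.mk₂ ℝ (fun v w ↦ secondFundamentalFormAt hf.contMDiffAt_two v w)
      (fun _ _ _ ↦ by simp) (fun _ _ _ ↦ by simp) (fun _ _ _ ↦ by simp) (fun _ _ _ ↦ by simp)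
  let e := stdOrthonormalBasis ℝ (TangentSpace I x)
  have hsplit : ∀ i, B (e i) (e i) = B (e i) ((verticalSpace I J f x).starProjection (e i)) +
      B (e i) ((horizontalSpace I J f x).starProjection (e i)) := fun i ↦ by
    rw [← map_add, starProjection_add_starProjection]
  calc tensionField I J f x = ∑ i, B (e i) (e i) := tensionField_eq_sum hf.contMDiffAt_two
    _ = ∑ i, B (e i) ((verticalSpace I J f x).starProjection (e i)) +
        ∑ i, B (e i) ((horizontalSpace I J f x).starProjection (e i)) := by
      rw [← Finset.sum_add_distrib]
      exact Finset.sum_congr rfl fun i _ ↦ hsplit i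
    _ = _ := by
      rw [sum_bilin_starProjection B e _ (stdOrthonormalBasis ℝ (verticalSpace I J f x)),
        sum_bilin_starProjection B e _ (stdOrthonormalBasis ℝ (horizontalSpace I J f x))]
      exact congrArg₂ (· + ·) hf.sum_secondFundamentalFormAt_vertical
        hf.sum_secondFundamentalFormAt_horizontal

end IsHorizontallyConformalSubmersion

end Tension

theorem mainTheorem1 (m n : ℕ)
    {E : Type*} [NormedAddCommGroup E] [NormedSpace ℝ E] [FiniteDimensional ℝ E]
    {H : Type*} [TopologicalSpace H] (I : ModelWithCorners ℝ E H) [I.Boundaryless]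
    {M : Type*} [TopologicalSpace M] [ChartedSpace H M] [IsManifold I ∞ M]
    [RiemannianBundle (fun x : M ↦ TangentSpace I x)]
    [IsContMDiffRiemannianBundle I ∞ E (fun x : M ↦ TangentSpace I x)]
    {E' : Type*} [NormedAddCommGroup E'] [NormedSpace ℝ E'] [FiniteDimensional ℝ E']
    {H' : Type*} [TopologicalSpace H'] (J : ModelWithCorners ℝ E' H') [J.Boundaryless]
    {N : Type*} [TopologicalSpace N] [ChartedSpace H' N] [IsManifold J ∞ N]
    [RiemannianBundle (fun y : N ↦ TangentSpace J y)]
    [IsContMDiffRiemannianBundle J ∞ E' (fun y : N ↦ TangentSpace J y)]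
    (hM : Module.finrank ℝ E = 2 * (m + n) + 1) (hN : Module.finrank ℝ E' = m + 2 * n + 1)
    (S : AlmostContactMetricStructure I M) (hS : S.IsSasakian)
    (f : M → N) (lam : M → ℝ) (hf : S.IsConformalAntiInvariantSubmersion J f lam) (x : M) :
    tensionField I J f x =
      -(m : ℝ) • mfderiv I J f x (verticalMeanCurvature I J f x) +
        (1 - (m : ℝ) - 2 * (n : ℝ)) •
          mfderiv I J f x (riemannianGradient I (fun y ↦ Real.log (lam y)) x) := by
  have hE' : Nontrivial E' := Module.nontrivial_of_finrank_pos (R := ℝ) (by omega)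
  have hsub := hf.toIsHorizontallyConformalSubmersion
  have hr : Module.finrank ℝ (verticalSpace I J f x) = m := by
    have := hsub.finrank_verticalSpace_add (x := x)
    omega
  have hc : 2 - (Module.finrank ℝ E' : ℝ) = 1 - (m : ℝ) - 2 * (n : ℝ) := by
    rw [hN]
    push_cast
    ring
  rw [hsub.tensionField_eq, hr, hc]
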